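/- Let $X$ and $Y$ be real normed spaces of the same finite dimension $n\ge 2$ which are polyhedral, i.e. whose closed unit balls $B_X$, $B_Y$ have only finitely many extreme points. Write $\operatorname{Ext} A$ for the set of extreme points of a convex set $A$, $X^*$ for the dual space, $J(x)=\{f\in X^*:\|f\|=1,\ f(x)=\|x\|\}$ for the set of supporting functionals at a non-zero $x\in X$, and, for $f\in\operatorname{Ext} B_{X^*}$, $\operatorname{Sm}(f)=\{x\in X\setminus\{0\}: J(x)=\{f\}\}$; use the same notation for $Y$. A pair $(x,y)$ is a parallel pair if $\|x+\lambda y\|=\|x\|+\|y\|$ for some scalar $\lambda\in\mathbb{R}$ with $|\lambda|=1$, and a triangle equality attaining (TEA) pair if $\|x+y\|=\|x\|+\|y\|$. Suppose that $|\operatorname{Ext} B_{X^*}|=|\operatorname{Ext} B_{Y^*}|$, and let $T:X\to Y$ be a bijective bounded linear operator which preserves parallel pairs (i.e. $(Tx,Ty)$ is a parallel pair in $Y$ whenever $(x,y)$ is a parallel pair in $X$) or which preserves TEA pairs (in the same sense). Then: (i) for each $f\in\operatorname{Ext} B_{X^*}$ there exists a unique $g\in\operatorname{Ext} B_{Y^*}$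 such that $T(\operatorname{Sm}(f))=\operatorname{Sm}(g)$; (ii) for each non-zero $x\in X$, $|\operatorname{Ext} J(x)|=|\operatorname{Ext} J(Tx)|$. -/

import Mathlib

namespace ParallelPairs

/-- The set of extreme points of the closed unit ball of a real normed space. -/
def extBall (X : Type*) [NormedAddCommGroup X] [NormedSpace ℝ X] : Set X :=
  Set.extremePoints ℝ (Metric.closedBall (0 : X) 1)

/-- A real normed space is polyhedral if it is finite-dimensional and its closed unit ball has
only finitely many extreme points. -/
def IsPolyhedral (X : Type*) [NormedAddCommGroup X] [NormedSpace ℝ X] : Prop :=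
  FiniteDimensional ℝ X ∧ (extBall X).Finite

/-- The set `J(x)` of supporting functionals at `x`; it is only used for `x ≠ 0`. -/
def supp {X : Type*} [NormedAddCommGroup X] [NormedSpace ℝ X] (x : X) :
    Set (StrongDual ℝ X) :=
  {f | ‖f‖ = 1 ∧ f x = ‖x‖}

/-- The set `Sm(f)` of smooth points whose unique supporting functional is `f`. -/
def smoothPts {X : Type*} [NormedAddCommGroup X] [NormedSpace ℝ X] (f : StrongDual ℝ X) :
    Set X :=
  {x | x ≠ 0 ∧ supp x = {f}}

/-- `(x, y)` is a parallel pair. -/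
def IsParallelPair {X : Type*} [NormedAddCommGroup X] [NormedSpace ℝ X] (x y : X) : Prop :=
  ∃ c : ℝ, |c| = 1 ∧ ‖x + c • y‖ = ‖x‖ + ‖y‖

/-- `(x, y)` is a triangle equality attaining (TEA) pair. -/
def IsTEAPair {X : Type*} [NormedAddCommGroup X] [NormedSpace ℝ X] (x y : X) : Prop :=
  ‖x + y‖ = ‖x‖ + ‖y‖

/-- `T` preserves parallel pairs. -/
def PreservesParallelPairs {X Y : Type*} [NormedAddCommGroup X] [NormedSpace ℝ X]
    [NormedAddCommGroup Y] [NormedSpace ℝ Y] (T : X →L[ℝ] Y) : Prop :=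
  ∀ x y : X, IsParallelPair x y → IsParallelPair (T x) (T y)

/-- `T` preserves TEA pairs. -/
def PreservesTEAPairs {X Y : Type*} [NormedAddCommGroup X] [NormedSpace ℝ X]
    [NormedAddCommGroup Y] [NormedSpace ℝ Y] (T : X →L[ℝ] Y) : Prop :=
  ∀ x y : X, IsTEAPair x y → IsTEAPair (T x) (T y)

end ParallelPairs

open Set

namespace ParallelPairs

/-! ### Extreme functionals and the cones they norm. -/

section Norming

variable {X : Type*} [NormedAddCommGroup X] [NormedSpace ℝ X]

/-! The norm is the maximum of the finitely many extreme functionals of the dual ball, so the space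
is a union of closed cones `C_f = {x | f x = ‖x‖}`, with open cores `strictCone f = smoothPts f`. A
vector parallel to a core point of `C_g` lies in `C_g` or `-C_g`; hence `T` sends each `C_f` into a
single `C_g` (`exists_apply_eq_norm`). The map `f ↦ g` is onto because `T` is, and equal cardinality
makes it bijective. Then `T` carries cones onto cones and cores onto cores (`exists_bijOn`). Part
(ii) follows since the extreme points of `J(x)` are the extreme `f` with `x ∈ C_f`. -/

theorem apply_le_norm_of_mem_extBall {f : StrongDual ℝ X} (hf : f ∈ extBall (StrongDual ℝ X))
    (x : X) : f x ≤ ‖x‖ := by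
  have h1 : ‖f‖ ≤ 1 := by simpa using hf.1
  calc f x ≤ ‖f x‖ := Real.le_norm_self _
    _ ≤ ‖f‖ * ‖x‖ := f.le_opNorm x
    _ ≤ 1 * ‖x‖ := by gcongr
    _ = ‖x‖ := one_mul _

theorem norm_le_one_of_apply_le_one (hX : IsPolyhedral X) {f : StrongDual ℝ X}
    (h : ∀ v ∈ extBall X, f v ≤ 1) : ‖f‖ ≤ 1 := by
  have := hX.1
  have : ProperSpace X := FiniteDimensional.proper ℝ X
  have hball : Metric.closedBall (0 : X) 1 ⊆ {x | f x ≤ 1} := by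
    rw [← closure_convexHull_extremePoints (isCompact_closedBall (0 : X) 1)
      (convex_closedBall (0 : X) 1)]
    refine closure_minimal (convexHull_min h ?_) ?_
    · exact convex_halfSpace_le f.toLinearMap.isLinear 1
    · exact isClosed_le f.continuous continuous_const
  refine f.opNorm_le_of_unit_norm zero_le_one fun x hx => ?_
  rw [Real.norm_eq_abs, abs_le]
  have h1 : f x ≤ 1 := hball (by simp [hx])
  have h2 : f (-x) ≤ 1 := hball (by simp [hx])
  rw [map_neg] at h2
  exact ⟨by linarith, h1⟩

/-- An extreme point of the dual ball is determined by the vertices at which it equals `1`. -/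
theorem finite_extBall_strongDual (hX : IsPolyhedral X) : (extBall (StrongDual ℝ X)).Finite := by
  refine Set.Finite.of_finite_image (f := fun f => {v ∈ extBall X | f v = 1})
    (hX.2.finite_subsets.subset ?_) ?_
  · rintro _ ⟨f, -, rfl⟩
    exact Set.sep_subset _ _
  intro f hf f' hf' heq
  have hle : ∀ h ∈ extBall (StrongDual ℝ X), ∀ v ∈ extBall X, h v ≤ 1 := fun h hh v hv =>
    (apply_le_norm_of_mem_extBall hh v).trans (by simpa using hv.1)
  -- Constraints tight at `f` are tight at `f'`, so they stay tight along the line; the finitely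
  -- many others have slack. Thus `f` is a midpoint inside the ball unless `f' = f`.
  have hsmall : ∀ v ∈ extBall X, ∀ᶠ t : ℝ in nhds 0, (f + t • (f' - f)) v ≤ 1 := by
    intro v hv
    by_cases h1 : f v = 1
    · have h2 : v ∈ {v ∈ extBall X | f' v = 1} := by
        have h3 : v ∈ {v ∈ extBall X | f v = 1} := ⟨hv, h1⟩
        exact heq.subset h3
      refine Filter.Eventually.of_forall fun t => ?_
      simp [h1, h2.2]
    · have hlt : f v < 1 := lt_of_le_of_ne (hle f hf v hv) h1
      have hc : Continuous fun t : ℝ => (f + t • (f' - f)) v := by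
        simp only [add_apply, smul_apply, smul_eq_mul]
        fun_prop
      have ht : Filter.Tendsto (fun t : ℝ => (f + t • (f' - f)) v) (nhds 0) (nhds (f v)) := by
        simpa using hc.tendsto 0
      exact (ht.eventually_lt_const hlt).mono fun t ht => ht.le
  have hall := (Filter.eventually_all_finite hX.2).2 hsmall
  obtain ⟨ε, hε, hball⟩ := Metric.eventually_nhds_iff.1 hall
  have hmem : ∀ t : ℝ, |t| < ε →
      f + t • (f' - f) ∈ Metric.closedBall (0 : StrongDual ℝ X) 1 := by
    intro t ht
    rw [mem_closedBall_zero_iff]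
    exact norm_le_one_of_apply_le_one hX (hball (by simpa using ht))
  have habs : |ε / 2| < ε := by rw [abs_of_pos (by linarith)]; linarith
  have hseg : f ∈ openSegment ℝ (f + (ε / 2) • (f' - f)) (f + (-(ε / 2)) • (f' - f)) :=
    ⟨1 / 2, 1 / 2, by norm_num, by norm_num, by norm_num, by module⟩
  have := hf.2 (hmem _ habs) (hmem _ (by rwa [abs_neg])) hseg
  have hz : (ε / 2) • (f' - f) = 0 := by simpa using this
  rcases smul_eq_zero.1 hz with h | h
  · linarith
  · exact (sub_eq_zero.1 h).symm

theorem isExtreme_face (x : X) :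
    IsExtreme ℝ (Metric.closedBall (0 : StrongDual ℝ X) 1)
      {f ∈ Metric.closedBall (0 : StrongDual ℝ X) 1 | f x = ‖x‖} := by
  have hle : ∀ f ∈ Metric.closedBall (0 : StrongDual ℝ X) 1, f x ≤ ‖x‖ := by
    intro f hf
    have h1 : ‖f‖ ≤ 1 := by simpa using hf
    calc f x ≤ ‖f x‖ := Real.le_norm_self _
      _ ≤ ‖f‖ * ‖x‖ := f.le_opNorm x
      _ ≤ 1 * ‖x‖ := by gcongr
      _ = ‖x‖ := one_mul _
  refine ⟨Set.sep_subset _ _, ?_⟩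
  rintro f hf g hg h hh ⟨a, b, ha, hb, hab, rfl⟩
  refine ⟨hf, le_antisymm (hle f hf) ?_⟩
  have h1 : a * f x + b * g x = ‖x‖ := by simpa using hh.2
  have h2 := hle g hg
  have : a * ‖x‖ ≤ a * f x := by
    have h3 := mul_le_mul_of_nonneg_left h2 hb.le
    have h4 : a * ‖x‖ + b * ‖x‖ = ‖x‖ := by rw [← add_mul, hab, one_mul]
    linarith
  exact le_of_mul_le_mul_left this ha

theorem supp_eq_face {x : X} (hx : x ≠ 0) :
    supp x = {f ∈ Metric.closedBall (0 : StrongDual ℝ X) 1 | f x = ‖x‖} := by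
  ext f
  simp only [supp, mem_ofPred_eq, mem_closedBall_zero_iff]
  refine ⟨fun h => ⟨h.1.le, h.2⟩, fun h => ⟨le_antisymm h.1 ?_, h.2⟩⟩
  have h1 := f.le_opNorm x
  rw [h.2, norm_norm] at h1
  exact le_of_mul_le_mul_right (by simpa using h1) (norm_pos_iff.2 hx)

theorem isCompact_face [FiniteDimensional ℝ X] (x : X) :
    IsCompact {f ∈ Metric.closedBall (0 : StrongDual ℝ X) 1 | f x = ‖x‖} := by
  have : ProperSpace (StrongDual ℝ X) := FiniteDimensional.proper ℝ _
  refine (isCompact_closedBall (0 : StrongDual ℝ X) 1).inter_right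
    (t := {f : StrongDual ℝ X | f x = ‖x‖}) ?_
  exact isClosed_eq (by fun_prop) continuous_const

theorem convex_face (x : X) :
    Convex ℝ {f ∈ Metric.closedBall (0 : StrongDual ℝ X) 1 | f x = ‖x‖} := by
  refine (convex_closedBall (0 : StrongDual ℝ X) 1).inter
    (t := {f : StrongDual ℝ X | f x = ‖x‖}) ?_
  exact convex_hyperplane (f := fun f : StrongDual ℝ X => f x)
    ⟨fun _ _ => rfl, fun _ _ => rfl⟩ ‖x‖

theorem exists_mem_extBall_apply_eq_norm [FiniteDimensional ℝ X] (x : X) :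
    ∃ f ∈ extBall (StrongDual ℝ X), f x = ‖x‖ := by
  obtain ⟨g, hg, hgx⟩ := exists_dual_vector'' ℝ x
  obtain ⟨f, hf⟩ := (isCompact_face x).extremePoints_nonempty
    ⟨g, mem_closedBall_zero_iff.2 hg, by simpa using hgx⟩
  exact ⟨f, (isExtreme_face x).extremePoints_subset_extremePoints hf, hf.1.2⟩

theorem extremePoints_supp {x : X} (hx : x ≠ 0) :
    extremePoints ℝ (supp x) = {f ∈ extBall (StrongDual ℝ X) | f x = ‖x‖} := by
  rw [supp_eq_face hx, (isExtreme_face x).extremePoints_eq]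
  ext f
  constructor
  · rintro ⟨h1, h2⟩
    exact ⟨h2, h1.2⟩
  · rintro ⟨h1, h2⟩
    exact ⟨⟨h1.1, h2⟩, h1⟩

/-- The points at which `f` is the only extreme functional of the dual ball attaining the norm. -/
def strictCone (f : StrongDual ℝ X) : Set X :=
  {x | ∀ f' ∈ extBall (StrongDual ℝ X), f' ≠ f → f' x < f x}

theorem apply_eq_norm_of_mem_strictCone [FiniteDimensional ℝ X] {f : StrongDual ℝ X}
    (hf : f ∈ extBall (StrongDual ℝ X)) {x : X} (hx : x ∈ strictCone f) : f x = ‖x‖ := by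
  obtain ⟨g, hg, hgx⟩ := exists_mem_extBall_apply_eq_norm x
  by_cases h : g = f
  · rwa [← h]
  · exact absurd (hx g hg h) (not_lt.2 (hgx ▸ apply_le_norm_of_mem_extBall hf x))

theorem eq_of_mem_strictCone {f g : StrongDual ℝ X} (hf : f ∈ extBall (StrongDual ℝ X))
    (hg : g ∈ extBall (StrongDual ℝ X)) {x : X} (hx : x ∈ strictCone f) (hgx : g x = ‖x‖) :
    g = f := by
  by_contra h
  exact absurd (hx g hg h) (not_lt.2 (hgx ▸ apply_le_norm_of_mem_extBall hf x))

theorem ne_zero_of_mem_strictCone [FiniteDimensional ℝ X] [Nontrivial X] {f : StrongDual ℝ X}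
    {x : X} (hx : x ∈ strictCone f) : x ≠ 0 := by
  rintro rfl
  have h : ∀ g ∈ extBall (StrongDual ℝ X), g = f := by
    intro g hg
    by_contra h
    simpa using hx g hg h
  obtain ⟨z, hz⟩ := exists_ne (0 : X)
  obtain ⟨g, hg, hgz⟩ := exists_mem_extBall_apply_eq_norm z
  obtain ⟨k, hk, hkz⟩ := exists_mem_extBall_apply_eq_norm (-z)
  rw [h g hg] at hgz
  rw [h k hk, map_neg, norm_neg] at hkz
  have := norm_pos_iff.2 hz
  linarith

/-- By Krein–Milman, the compact convex set `supp x` is a singleton once it has only one extreme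
point. -/
theorem smoothPts_eq_strictCone [FiniteDimensional ℝ X] [Nontrivial X] {f : StrongDual ℝ X}
    (hf : f ∈ extBall (StrongDual ℝ X)) : smoothPts f = strictCone f := by
  ext x
  constructor
  · rintro ⟨hx, hs⟩ g hg hne
    have hfx : f x = ‖x‖ := (show f ∈ supp x by rw [hs]; rfl).2
    rw [hfx]
    refine lt_of_le_of_ne (apply_le_norm_of_mem_extBall hg x) fun h => hne ?_
    have : g ∈ extremePoints ℝ (supp x) := by
      rw [extremePoints_supp hx]
      exact ⟨hg, h⟩
    simpa [hs] using this.1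
  · intro hx
    have h0 := ne_zero_of_mem_strictCone hx
    refine ⟨h0, ?_⟩
    have hext : extremePoints ℝ (supp x) = {f} := by
      rw [extremePoints_supp h0]
      ext g
      refine ⟨fun h => eq_of_mem_strictCone hf h.1 hx h.2, ?_⟩
      rintro rfl
      exact ⟨hf, apply_eq_norm_of_mem_strictCone hf hx⟩
    have hK := closure_convexHull_extremePoints (s := supp x)
      (by rw [supp_eq_face h0]; exact isCompact_face x)
      (by rw [supp_eq_face h0]; exact convex_face x)
    rw [hext, convexHull_singleton, closure_singleton] at hK
    exact hK.symm

/-- An extreme `f` lies outside the compact hull of the other extreme functionals; the separating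
functional is evaluation at a point, by reflexivity. -/
theorem strictCone_nonempty (hX : IsPolyhedral X) {f : StrongDual ℝ X}
    (hf : f ∈ extBall (StrongDual ℝ X)) : (strictCone f).Nonempty := by
  have := hX.1
  have hfin : (extBall (StrongDual ℝ X) \ {f}).Finite := (finite_extBall_strongDual hX).sdiff
  have hnot : f ∉ convexHull ℝ (extBall (StrongDual ℝ X) \ {f}) := by
    have hconv := ((convex_closedBall (0 : StrongDual ℝ X) 1).mem_extremePoints_iff_convex_sdiff.1
      hf).2
    intro h
    exact (convexHull_min (sdiff_subset_sdiff_left fun g hg => hg.1) hconv h).2 rfl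
  obtain ⟨φ, u, h1, h2⟩ := geometric_hahn_banach_closed_point (convex_convexHull ℝ _)
    (hfin.isCompact_convexHull ℝ).isClosed hnot
  obtain ⟨x, hx⟩ : ∃ x : X, ∀ g : StrongDual ℝ X, φ g = g x := by
    let e : StrongDual ℝ X ≃ₗ[ℝ] Module.Dual ℝ X := LinearMap.toContinuousLinearMap.symm
    obtain ⟨x, hx⟩ := (Module.evalEquiv ℝ X).surjective (φ.toLinearMap ∘ₗ e.symm.toLinearMap)
    refine ⟨x, fun g => ?_⟩
    have := LinearMap.congr_fun hx (e g)
    have hg : e.symm (e g) = g := e.symm_apply_apply g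
    calc φ g = φ (e.symm (e g)) := by rw [hg]
      _ = g x := this.symm
  refine ⟨x, fun g hg hne => ?_⟩
  rw [← hx, ← hx]
  exact (h1 g (subset_convexHull ℝ _ ⟨hg, hne⟩)).trans h2

theorem add_smul_mem_strictCone {f : StrongDual ℝ X} {x s : X} (hx : f x = ‖x‖)
    (hs : s ∈ strictCone f) {t : ℝ} (ht : 0 < t) : x + t • s ∈ strictCone f := by
  intro g hg hne
  have h1 := hx ▸ apply_le_norm_of_mem_extBall hg x
  have h2 := mul_lt_mul_of_pos_left (hs g hg hne) ht
  simpa using add_lt_add_of_le_of_lt h1 h2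

theorem exists_add_smul_mem_strictCone (hX : IsPolyhedral X) {f : StrongDual ℝ X} {s : X}
    (hs : s ∈ strictCone f) (v : X) : ∃ t : ℝ, 0 < t ∧ s + t • v ∈ strictCone f := by
  have h : ∀ g ∈ extBall (StrongDual ℝ X),
      ∀ᶠ t : ℝ in nhds 0, g ≠ f → g (s + t • v) < f (s + t • v) := by
    intro g hg
    by_cases hne : g = f
    · exact Filter.Eventually.of_forall fun t h => absurd hne h
    have hg' : ContinuousAt (fun t : ℝ => g (s + t • v)) 0 := by fun_prop
    have hf' : ContinuousAt (fun t : ℝ => f (s + t • v)) 0 := by fun_prop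
    exact (hg'.eventually_lt hf' (by simpa using hs g hg hne)).mono fun t h _ => h
  have hall := (Filter.eventually_all_finite (finite_extBall_strongDual hX)).2 h
  obtain ⟨ε, hε, hb⟩ := Metric.eventually_nhds_iff.1 hall
  refine ⟨ε / 2, by linarith, hb ?_⟩
  rw [Real.dist_eq, sub_zero, abs_of_pos] <;> linarith

/-- An extreme functional norming `x + c • y` norms both summands, and the only one norming `x` is
`f`. -/
theorem IsParallelPair.apply_eq_norm_or [FiniteDimensional ℝ X] {f : StrongDual ℝ X}
    (hf : f ∈ extBall (StrongDual ℝ X)) {x y : X} (hx : x ∈ strictCone f)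
    (h : IsParallelPair x y) : f y = ‖y‖ ∨ f y = -‖y‖ := by
  obtain ⟨c, hc, h⟩ := h
  obtain ⟨g, hg, hgxy⟩ := exists_mem_extBall_apply_eq_norm (x + c • y)
  have h1 := apply_le_norm_of_mem_extBall hg x
  have h2 := apply_le_norm_of_mem_extBall hg (c • y)
  have hcy : ‖c • y‖ = ‖y‖ := by rw [norm_smul, Real.norm_eq_abs, hc, one_mul]
  rw [h, map_add] at hgxy
  rw [hcy] at h2
  have hgf : g = f := eq_of_mem_strictCone hf hg hx (by linarith)
  have h3 : c * f y = ‖y‖ := by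
    rw [← hgf, ← smul_eq_mul, ← map_smul]
    linarith
  rcases (abs_eq zero_le_one).1 hc with rfl | rfl
  · left; linarith
  · right; linarith

theorem isParallelPair_of_apply_eq_norm {f : StrongDual ℝ X}
    (hf : f ∈ extBall (StrongDual ℝ X)) {x y : X} (hx : f x = ‖x‖) (hy : f y = ‖y‖) :
    IsParallelPair x y := by
  refine ⟨1, abs_one, ?_⟩
  rw [one_smul]
  refine le_antisymm (norm_add_le x y) ?_
  rw [← hx, ← hy, ← map_add]
  exact apply_le_norm_of_mem_extBall hf _

end Norming

/-! ### The correspondence of cones induced by `T`. -/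

section Operator

variable {X Y : Type*} [NormedAddCommGroup X] [NormedSpace ℝ X]
  [NormedAddCommGroup Y] [NormedSpace ℝ Y]

theorem PreservesTEAPairs.preservesParallelPairs {T : X →L[ℝ] Y} (hT : PreservesTEAPairs T) :
    PreservesParallelPairs T := by
  rintro x y ⟨c, hc, h⟩
  refine ⟨c, hc, ?_⟩
  have := hT x (c • y) (by rw [IsTEAPair, h, norm_smul, Real.norm_eq_abs, hc, one_mul])
  rw [IsTEAPair, map_smul] at this
  rw [this, norm_smul, Real.norm_eq_abs, hc, one_mul]

/-- `T` maps the cone of points normed by `f` into the cone of points normed by some `g`. -/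
theorem PreservesParallelPairs.exists_apply_eq_norm (hX : IsPolyhedral X) (hY : IsPolyhedral Y)
    [Nontrivial X] {T : X →L[ℝ] Y} (hbij : Function.Bijective T)
    (hT : PreservesParallelPairs T) {f : StrongDual ℝ X} (hf : f ∈ extBall (StrongDual ℝ X)) :
    ∃ g ∈ extBall (StrongDual ℝ Y), ∀ x, f x = ‖x‖ → g (T x) = ‖T x‖ := by
  have := hX.1
  have := hY.1
  obtain ⟨s, hs⟩ := strictCone_nonempty hX hf
  obtain ⟨g, hg, hgs⟩ := exists_mem_extBall_apply_eq_norm (T s)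
  obtain ⟨r, hr⟩ := strictCone_nonempty hY hg
  obtain ⟨v, rfl⟩ := hbij.2 r
  -- Nudging `s` towards the preimage of a core point of `g` puts `a` and `T a` in both cores at
  -- once.
  obtain ⟨t, ht, hst⟩ := exists_add_smul_mem_strictCone hX hs v
  set a := s + t • v with ha
  have hTa : T a ∈ strictCone g := by
    simpa [ha] using add_smul_mem_strictCone hgs hr ht
  have hfa := apply_eq_norm_of_mem_strictCone hf hst
  have hga := apply_eq_norm_of_mem_strictCone hg hTa
  have ha0 : a ≠ 0 := ne_zero_of_mem_strictCone hst
  have hTa0 : 0 < ‖T a‖ := norm_pos_iff.2 fun h => ha0 (hbij.1 (by rw [h, map_zero]))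
  have hpm : ∀ x, f x = ‖x‖ → g (T x) = ‖T x‖ ∨ g (T x) = -‖T x‖ := fun x hx =>
    (hT a x (isParallelPair_of_apply_eq_norm hf hfa hx)).apply_eq_norm_or hg hTa
  refine ⟨g, hg, fun x hx => ?_⟩
  by_cases hx0 : x = 0
  · simp [hx0]
  refine (hpm x hx).resolve_right fun hneg => ?_
  -- The weights make `g ∘ T` vanish at this vector of `C_f`, forcing it to be zero although `f` is
  -- positive there.
  have hzf : f (‖T x‖ • a + ‖T a‖ • x) = ‖‖T x‖ • a + ‖T a‖ • x‖ := by
    refine le_antisymm (apply_le_norm_of_mem_extBall hf _) ((norm_add_le _ _).trans ?_)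
    simp [norm_smul, hfa, hx]
  have hgz : g (T (‖T x‖ • a + ‖T a‖ • x)) = 0 := by
    simp only [map_add, map_smul, smul_eq_mul, hga, hneg]
    ring
  have hz : ‖T (‖T x‖ • a + ‖T a‖ • x)‖ = 0 := by
    rcases hpm _ hzf with h | h <;> linarith
  have hz0 : ‖T x‖ • a + ‖T a‖ • x = 0 := hbij.1 (by rw [norm_eq_zero.1 hz, map_zero])
  have hfz : ‖T x‖ * ‖a‖ + ‖T a‖ * ‖x‖ = 0 := by
    rw [← hfa, ← hx, ← smul_eq_mul, ← smul_eq_mul, ← map_smul, ← map_smul, ← map_add, hz0,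
      map_zero]
  have h1 : 0 < ‖T a‖ * ‖x‖ := mul_pos hTa0 (norm_pos_iff.2 hx0)
  have h2 : 0 ≤ ‖T x‖ * ‖a‖ := by positivity
  linarith

/-- A bijection between the extreme functionals compatible with `T`, with the induced
correspondence of cones. -/
theorem PreservesParallelPairs.exists_bijOn (hX : IsPolyhedral X) (hY : IsPolyhedral Y)
    [Nontrivial X] {T : X →L[ℝ] Y} (hbij : Function.Bijective T)
    (hT : PreservesParallelPairs T)
    (hcard : (extBall (StrongDual ℝ X)).encard = (extBall (StrongDual ℝ Y)).encard) :
    ∃ φ : StrongDual ℝ X → StrongDual ℝ Y,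
      BijOn φ (extBall (StrongDual ℝ X)) (extBall (StrongDual ℝ Y)) ∧
      (∀ f ∈ extBall (StrongDual ℝ X), T '' strictCone f = strictCone (φ f)) ∧
      ∀ f ∈ extBall (StrongDual ℝ X), ∀ x, f x = ‖x‖ ↔ φ f (T x) = ‖T x‖ := by
  have := hX.1
  have := hY.1
  have hfinX := finite_extBall_strongDual hX
  choose! φ hφ hφT using fun f (hf : f ∈ extBall (StrongDual ℝ X)) =>
    hT.exists_apply_eq_norm hX hY hbij hf
  have hsurj : SurjOn φ (extBall (StrongDual ℝ X)) (extBall (StrongDual ℝ Y)) := by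
    intro g hg
    obtain ⟨y, hy⟩ := strictCone_nonempty hY hg
    obtain ⟨x, rfl⟩ := hbij.2 y
    obtain ⟨f, hf, hfx⟩ := exists_mem_extBall_apply_eq_norm x
    exact ⟨f, hf, eq_of_mem_strictCone hg (hφ f hf) hy (hφT f hf x hfx)⟩
  have himage : φ '' extBall (StrongDual ℝ X) = extBall (StrongDual ℝ Y) :=
    (mapsTo_iff_image_subset.1 hφ).antisymm hsurj
  have hinj : InjOn φ (extBall (StrongDual ℝ X)) :=
    hfinX.injOn_of_encard_image_eq (by rw [himage, hcard])
  have hcone : ∀ f ∈ extBall (StrongDual ℝ X), ∀ x, T x ∈ strictCone (φ f) →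
      x ∈ strictCone f := by
    intro f hf x hx f' hf' hne
    obtain ⟨k, hk, hkx⟩ := exists_mem_extBall_apply_eq_norm x
    have huniq : ∀ k ∈ extBall (StrongDual ℝ X), k x = ‖x‖ → k = f := fun k hk hkx =>
      hinj hk hf (eq_of_mem_strictCone (hφ f hf) (hφ k hk) hx (hφT k hk x hkx))
    rw [← huniq k hk hkx, hkx]
    exact lt_of_le_of_ne (apply_le_norm_of_mem_extBall hf' x) fun h => hne (huniq f' hf' h)
  refine ⟨φ, ⟨hφ, hinj, hsurj⟩, fun f hf => Subset.antisymm ?_ ?_, fun f hf x =>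
    ⟨hφT f hf x, fun hx => ?_⟩⟩
  · rintro _ ⟨x, hx, rfl⟩ g hg hne
    have hTx := hφT f hf x (apply_eq_norm_of_mem_strictCone hf hx)
    rw [hTx]
    refine lt_of_le_of_ne (apply_le_norm_of_mem_extBall hg _) fun hgx => hne ?_
    -- Near `x`, `φ f` norms the image, so it dominates `g`, with equality at `T x`; by linearity it
    -- dominates in every direction.
    have hle : ∀ y, g y ≤ φ f y := by
      intro y
      obtain ⟨v, rfl⟩ := hbij.2 y
      obtain ⟨t, ht, hxt⟩ := exists_add_smul_mem_strictCone hX hx v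
      have h1 := hφT f hf _ (apply_eq_norm_of_mem_strictCone hf hxt)
      have h2 := h1 ▸ apply_le_norm_of_mem_extBall hg (T (x + t • v))
      simp only [map_add, map_smul, smul_eq_mul, hgx, hTx] at h2
      exact le_of_mul_le_mul_left (by linarith) ht
    ext y
    refine le_antisymm (hle y) ?_
    have := hle (-y)
    simpa using this
  · intro y hy
    obtain ⟨x, rfl⟩ := hbij.2 y
    exact ⟨x, hcone f hf x hy, rfl⟩
  · obtain ⟨s, hs⟩ := strictCone_nonempty hY (hφ f hf)
    obtain ⟨v, rfl⟩ := hbij.2 s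
    -- Approach `x` through points whose images lie in the core, then let `t → 0`.
    have hpos : ∀ t : ℝ, 0 < t → f (x + t • v) = ‖x + t • v‖ := fun t ht =>
      apply_eq_norm_of_mem_strictCone hf
        (hcone f hf _ (by simpa using add_smul_mem_strictCone hx hs ht))
    have hclosed : IsClosed {t : ℝ | f (x + t • v) = ‖x + t • v‖} :=
      isClosed_eq (by fun_prop) (by fun_prop)
    have h0 : (0 : ℝ) ∈ closure (Ioi (0 : ℝ)) := by simp
    have hmem : f (x + (0 : ℝ) • v) = ‖x + (0 : ℝ) • v‖ :=
      closure_minimal (fun t ht => hpos t ht) hclosed h0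
    simpa using hmem

end Operator

end ParallelPairs

theorem mainTheorem11 {X Y : Type*} [NormedAddCommGroup X] [NormedSpace ℝ X]
    [NormedAddCommGroup Y] [NormedSpace ℝ Y] (n : ℕ) (hn : 1 < n)
    (hXn : Module.finrank ℝ X = n) (hYn : Module.finrank ℝ Y = n)
    (hX : ParallelPairs.IsPolyhedral X) (hY : ParallelPairs.IsPolyhedral Y)
    (hcard : (ParallelPairs.extBall (StrongDual ℝ X)).encard =
      (ParallelPairs.extBall (StrongDual ℝ Y)).encard)
    (T : X →L[ℝ] Y) (hbij : Function.Bijective T)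
    (hT : ParallelPairs.PreservesParallelPairs T ∨ ParallelPairs.PreservesTEAPairs T) :
    (∀ f ∈ ParallelPairs.extBall (StrongDual ℝ X),
      ∃! g : StrongDual ℝ Y, g ∈ ParallelPairs.extBall (StrongDual ℝ Y) ∧
        T '' ParallelPairs.smoothPts f = ParallelPairs.smoothPts g) ∧
    (∀ x : X, x ≠ 0 →
      (Set.extremePoints ℝ (ParallelPairs.supp x)).encard =
        (Set.extremePoints ℝ (ParallelPairs.supp (T x))).encard) := by
  have := hX.1
  have := hY.1
  have : Nontrivial X := Module.nontrivial_of_finrank_pos (R := ℝ) (by omega)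
  have : Nontrivial Y := Module.nontrivial_of_finrank_pos (R := ℝ) (by omega)
  have hT' : ParallelPairs.PreservesParallelPairs T :=
    hT.elim id ParallelPairs.PreservesTEAPairs.preservesParallelPairs
  obtain ⟨φ, hφ, hcone, hiff⟩ := hT'.exists_bijOn hX hY hbij hcard
  constructor
  · intro f hf
    refine ⟨φ f, ⟨hφ.mapsTo hf, ?_⟩, ?_⟩
    · rw [ParallelPairs.smoothPts_eq_strictCone hf,
        ParallelPairs.smoothPts_eq_strictCone (hφ.mapsTo hf), hcone f hf]
    · rintro g ⟨hg, hgf⟩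
      rw [ParallelPairs.smoothPts_eq_strictCone hf, ParallelPairs.smoothPts_eq_strictCone hg,
        hcone f hf] at hgf
      obtain ⟨y, hy⟩ := ParallelPairs.strictCone_nonempty hY hg
      exact (ParallelPairs.eq_of_mem_strictCone hg (hφ.mapsTo hf) hy
        (ParallelPairs.apply_eq_norm_of_mem_strictCone (hφ.mapsTo hf) (hgf ▸ hy))).symm
  · intro x hx
    have hTx : T x ≠ 0 := fun h => hx (hbij.1 (by rw [h, map_zero]))
    rw [ParallelPairs.extremePoints_supp hx, ParallelPairs.extremePoints_supp hTx,
      ← (hφ.injOn.mono (Set.sep_subset _ _)).encard_image]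
    congr 1
    ext g
    constructor
    · rintro ⟨f, ⟨hf, hfx⟩, rfl⟩
      exact ⟨hφ.mapsTo hf, (hiff f hf x).1 hfx⟩
    · rintro ⟨hg, hgx⟩
      obtain ⟨f, hf, rfl⟩ := hφ.surjOn hg
      exact ⟨f, ⟨hf, (hiff f hf x).2 hgx⟩, rfl⟩
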